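/- A tournament is a digraph without loops in which any two distinct vertices are joined by exactly one directed edge; it is transitive if $a\to b$ and $b\to c$ imply $a\to c$. For integers $t,m\ge 1$, let $R_t(m)$ denote the directed Ramsey number, i.e. the least positive integer $n$ such that every tournament with $n$ vertices, whose edges have been colored in $t$ colors, contains a monochromatic transitive subtournament of order $m$. Theorem 1.2. For every integer $t\ge 4$, $$R_t(3)\ \ge\ 169\cdot 3^{t-4}+1,$$ and for every integer $t\ge 2$, $$R_t(6)\ \ge\ 829\cdot 27^{t-2}+1\qquad\text{and}\qquad R_t(8)\ \ge\ 3320\cdot 56^{t-2}+1 .$$ -/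

import Mathlib

namespace DirectedRamsey

/-- A digraph is a tournament if it has no loops and any two distinct vertices are joined by
exactly one of the two possible directed edges. -/
def IsTournament {V : Type*} (G : Digraph V) : Prop :=
  (∀ v, ¬ G.Adj v v) ∧ ∀ u v, u ≠ v → Xor (G.Adj u v) (G.Adj v u)

/-- A coloring of the edges of `G` in `t` colors: a color for each edge `u → v` of `G`. -/
abbrev EdgeColoring {V : Type*} (G : Digraph V) (t : ℕ) : Type _ :=
  ∀ u v, G.Adj u v → Fin t

/-- The subgraph of `G` induced on `S` is transitive:
`a → b` and `b → c` imply `a → c` for vertices in `S`. -/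
def IsTransitiveOn {V : Type*} (G : Digraph V) (S : Finset V) : Prop :=
  ∀ a ∈ S, ∀ b ∈ S, ∀ c ∈ S, G.Adj a b → G.Adj b c → G.Adj a c

/-- All edges of `G` between vertices of `S` have the same color. -/
def IsMonochromaticOn {V : Type*} {G : Digraph V} {t : ℕ} (χ : EdgeColoring G t)
    (S : Finset V) : Prop :=
  ∃ i : Fin t, ∀ u ∈ S, ∀ v ∈ S, ∀ h : G.Adj u v, χ u v h = i

/-- Every tournament with `n` vertices whose edges are colored in `t` colors contains a
monochromatic transitive subtournament of order `m`. -/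
def RamseyProperty (t m n : ℕ) : Prop :=
  ∀ G : Digraph (Fin n), IsTournament G → ∀ χ : EdgeColoring G t,
    ∃ S : Finset (Fin n), S.card = m ∧ IsTransitiveOn G S ∧ IsMonochromaticOn χ S

/-- The directed Ramsey number `R_t(m)`: the least positive integer `n` with
`RamseyProperty t m n`. (Were there no such integer, this `sInf` would be `0`.) -/
noncomputable def directedRamsey (t m : ℕ) : ℕ :=
  sInf {n : ℕ | 0 < n ∧ RamseyProperty t m n}

end DirectedRamsey

/-! A monochromatic transitive subtournament, listed in order, is a chain of one colour. So
relations that join every pair of `N` vertices, none having a chain of length `m`, give `N + 1 ≤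
R_t(m)` (`HasCover.lt_directedRamsey`). Ramsey's theorem is needed as well, since the `sInf` would
be `0` for an empty set. Lexicographic products add colours and multiply orders
(`HasCover.mul_pow`), so a few base covers suffice.

They come from a field of order `q = 2tn + 1`, `n` odd, where `x → y` is coloured by the class of
`(y - x) ^ n`. Affine maps bring any chain to start with `0, 1`, leaving a small search: `q = 169,
829, 27`. For `m = 8` the vertices are nonzero plane vectors up to `n`-th roots of unity, `2t(q +
1)` in all (`3320` and `56`), coloured by determinants; this raises the forbidden length by only 2.
The order `3` cover is the cyclic triangle. -/

namespace DirectedRamsey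

/-! ### Chain-free covers and their products -/

/-- Relations `E i` that together join any two distinct vertices, such that no `E i` contains a
chain of length `m`. -/
structure ChainFreeCover {ι V : Type*} (E : ι → V → V → Prop) (m : ℕ) : Prop where
  total : ∀ u v, u ≠ v → ∃ i, E i u v ∨ E i v u
  chainFree : ∀ i (l : List V), l.Pairwise (E i) → l.length ≠ m

/-- There is a chain-free cover with `t` relations on `N` vertices. -/
def HasCover (t m N : ℕ) : Prop :=
  ∃ E : Fin t → Fin N → Fin N → Prop, ChainFreeCover E m

theorem ChainFreeCover.comap {ι κ V W : Type*} {E : ι → V → V → Prop} {m : ℕ}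
    (h : ChainFreeCover E m) (e : ι ≃ κ) {f : W → V} (hf : Function.Injective f) :
    ChainFreeCover (fun k u v => E (e.symm k) (f u) (f v)) m where
  total u v huv := by
    obtain ⟨i, hi⟩ := h.total (f u) (f v) (hf.ne huv)
    exact ⟨e i, by simpa using hi⟩
  chainFree i l hl := by
    have := h.chainFree (e.symm i) (l.map f) (List.pairwise_map.2 hl)
    simpa using this

theorem ChainFreeCover.hasCover {ι V : Type*} [Fintype ι] [Fintype V] {E : ι → V → V → Prop}
    {m t N : ℕ} (h : ChainFreeCover E m) (ht : Fintype.card ι = t) (hN : N ≤ Fintype.card V) :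
    HasCover t m N :=
  ⟨_, h.comap (Fintype.equivFinOfCardEq ht)
    (f := fun x : Fin N => (Fintype.equivFin V).symm (Fin.castLE hN x))
    ((Fintype.equivFin V).symm.injective.comp (Fin.castLE_injective hN))⟩

theorem HasCover.mono {t m N n : ℕ} (h : HasCover t m N) (hn : n ≤ N) : HasCover t m n := by
  obtain ⟨E, hE⟩ := h
  exact hE.hasCover (by simp) (by simpa using hn)

/-- Covers of two vertex sets combine to a cover of the product. -/
theorem ChainFreeCover.prod {ι κ V W : Type*} {E : ι → V → V → Prop} {E' : κ → W → W → Prop}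
    {m : ℕ} (h : ChainFreeCover E m) (h' : ChainFreeCover E' m) :
    ChainFreeCover (fun (k : ι ⊕ κ) (x y : V × W) =>
      Sum.elim (fun i => E i x.1 y.1) (fun j => x.1 = y.1 ∧ E' j x.2 y.2) k) m where
  total u v huv := by
    by_cases h1 : u.1 = v.1
    · obtain ⟨j, hj⟩ := h'.total u.2 v.2 fun h2 => huv (Prod.ext h1 h2)
      exact ⟨Sum.inr j, by simpa [h1] using hj⟩
    · obtain ⟨i, hi⟩ := h.total _ _ h1
      exact ⟨Sum.inl i, hi⟩
  chainFree k l hl := by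
    -- A chain in an outer colour projects to the first factor; one in an inner colour projects to
    -- the second.
    rcases k with i | j
    · simpa using h.chainFree i (l.map Prod.fst) (List.pairwise_map.2 hl)
    · simpa using h'.chainFree j (l.map Prod.snd)
        (List.pairwise_map.2 (hl.imp fun hxy => hxy.2))

theorem HasCover.mul {t t' m N N' : ℕ} (h : HasCover t m N) (h' : HasCover t' m N') :
    HasCover (t + t') m (N * N') := by
  obtain ⟨E, hE⟩ := h
  obtain ⟨E', hE'⟩ := h'
  exact (hE.prod hE').hasCover (by simp) (by simp)

theorem HasCover.mul_pow {t m N M : ℕ} (h : HasCover t m N) (h' : HasCover 1 m M) (k : ℕ) :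
    HasCover (t + k) m (N * M ^ k) := by
  induction k with
  | zero => simpa using h
  | succ k ih => simpa [pow_succ, mul_assoc, add_assoc] using ih.mul h'

/-! ### From covers to colored tournaments -/

/-- A finite set on which `r` is a strict total order can be listed increasingly. -/
theorem exists_pairwise_list {V : Type*} (r : V → V → Prop) (S : Finset V)
    (htot : ∀ a ∈ S, ∀ b ∈ S, a ≠ b → r a b ∨ r b a) (hirr : ∀ a b, r a b → ¬ r b a)
    (htrans : ∀ a ∈ S, ∀ b ∈ S, ∀ c ∈ S, r a b → r b c → r a c) :
    ∃ l : List V, (∀ x ∈ l, x ∈ S) ∧ l.length = S.card ∧ l.Pairwise r := by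
  classical
  let r' : S → S → Prop := fun a b => a = b ∨ r a b
  have : Std.Total r' := ⟨fun a b => by
    by_cases h : a = b
    · exact Or.inl (Or.inl h)
    · exact (htot a a.2 b b.2 fun h' => h (Subtype.ext h')).imp Or.inr Or.inr⟩
  have : IsTrans S r' := ⟨fun a b c hab hbc => by
    rcases hab with rfl | hab
    · exact hbc
    rcases hbc with rfl | hbc
    · exact Or.inr hab
    exact Or.inr (htrans a a.2 b b.2 c c.2 hab hbc)⟩
  have : Std.Antisymm r' := ⟨fun a b hab hba => by
    rcases hab with h | hab
    · exact h
    rcases hba with h | hba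
    · exact h.symm
    exact absurd hba (hirr _ _ hab)⟩
  refine ⟨((Finset.univ : Finset S).sort r').map Subtype.val, ?_, by simp, ?_⟩
  · intro x hx
    obtain ⟨y, -, rfl⟩ := List.mem_map.1 hx
    exact y.2
  · rw [List.pairwise_map]
    have h1 := Finset.pairwise_sort (Finset.univ : Finset S) r'
    have h2 := Finset.sort_nodup (Finset.univ : Finset S) r'
    exact h1.imp₂ (fun a b hab hne => hab.resolve_left hne) h2

theorem HasCover.not_ramseyProperty {t m n : ℕ} (h : HasCover t m n) :
    ¬ RamseyProperty t m n := by
  classical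
  obtain ⟨E, hE⟩ := h
  intro hR
  -- A cover may relate a pair both ways; the order on `Fin n` settles which direction to keep.
  let G : Digraph (Fin n) :=
    ⟨fun u v => (u < v ∧ ∃ i, E i u v) ∨ (v < u ∧ ¬ ∃ i, E i v u)⟩
  have hG : IsTournament G := by
    refine ⟨fun v => by simp [G], fun u v huv => ?_⟩
    rcases lt_or_gt_of_ne huv with hlt | hlt
    · by_cases hex : ∃ i, E i u v <;> simp [G, Xor, hlt, hlt.not_gt, hex]
    · by_cases hex : ∃ i, E i v u <;> simp [G, Xor, hlt, hlt.not_gt, hex]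
  have hAdj : ∀ u v, G.Adj u v → ∃ i, E i u v := by
    rintro u v (⟨-, h⟩ | ⟨hlt, h⟩)
    · exact h
    · obtain ⟨i, hi⟩ := hE.total u v hlt.ne'
      exact ⟨i, hi.resolve_right fun h' => h ⟨i, h'⟩⟩
  choose χ hχ using hAdj
  obtain ⟨S, hS, htr, i, hmono⟩ := hR G hG χ
  obtain ⟨l, hlS, hlen, hl⟩ := exists_pairwise_list G.Adj S
    (fun a _ b _ hab => (hG.2 a b hab).or)
    (fun a b hab hba => by
      have hne : a ≠ b := by rintro rfl; exact hG.1 _ hab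
      rcases hG.2 a b hne with h | h
      · exact h.2 hba
      · exact h.2 hab) htr
  refine hE.chainFree i l (hl.imp_of_mem fun {a b} ha hb hab => ?_) (hlen.trans hS)
  have := hχ a b hab
  rwa [hmono a (hlS a ha) b (hlS b hb) hab] at this

/-! ### Finiteness of the directed Ramsey numbers -/

/-- Ramsey's theorem for relations joining any two vertices. -/
theorem exists_chain_of_card_le (V : Type) (t : ℕ) (s : ℕ) : ∀ f : Fin t → ℕ, ∑ i, f i = s →
    ∃ N, ∀ (S : Finset V) (E : Fin t → V → V → Prop),
      (∀ u ∈ S, ∀ v ∈ S, u ≠ v → ∃ i, E i u v ∨ E i v u) → N ≤ S.card →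
      ∃ i, ∃ l : List V, (∀ x ∈ l, x ∈ S) ∧ l.Pairwise (E i) ∧ l.length = f i := by
  classical
  induction s with
  | zero =>
    intro f hf
    -- Two vertices guarantee that a colour exists, which fails when `t = 0`.
    refine ⟨2, fun S E hE hS => ?_⟩
    obtain ⟨u, hu, v, hv, huv⟩ := Finset.one_lt_card.1 hS
    obtain ⟨i, -⟩ := hE u hu v hv huv
    refine ⟨i, [], by simp, List.Pairwise.nil, ?_⟩
    exact ((Finset.sum_eq_zero_iff.1 hf) i (Finset.mem_univ i)).symm
  | succ s ih =>
    intro f hf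
    by_cases hz : ∃ i, f i = 0
    · obtain ⟨i, hi⟩ := hz
      exact ⟨0, fun S E _ _ => ⟨i, [], by simp, List.Pairwise.nil, hi.symm⟩⟩
    push Not at hz
    have key : ∀ i, ∑ j, Function.update f i (f i - 1) j = s := by
      intro i
      have h1 := Finset.add_sum_erase Finset.univ f (Finset.mem_univ i)
      have h2 := Finset.add_sum_erase Finset.univ (Function.update f i (f i - 1))
        (Finset.mem_univ i)
      have h3 : ∑ j ∈ Finset.univ.erase i, Function.update f i (f i - 1) j
          = ∑ j ∈ Finset.univ.erase i, f j :=
        Finset.sum_congr rfl fun j hj => Function.update_of_ne (Finset.ne_of_mem_erase hj) _ _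
      rw [h3, Function.update_self] at h2
      have := hz i
      omega
    choose N hN using fun i => ih _ (key i)
    refine ⟨2 + ∑ i, (N i + N i), fun S E hE hS => ?_⟩
    obtain ⟨v, hv⟩ : S.Nonempty := Finset.card_pos.1 (by omega)
    -- A chain found among the out-neighbours of `v` is extended by `v` in front, one among its
    -- in-neighbours by `v` at the end.
    by_cases hbig : ∃ i, N i ≤ ((S.erase v).filter (E i v)).card ∨
        N i ≤ ((S.erase v).filter (E i · v)).card
    · obtain ⟨i, hi | hi⟩ := hbig
      · obtain ⟨j, l, hlS, hl, hlen⟩ := hN i _ E (fun a ha b hb =>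
          hE a (Finset.mem_of_mem_erase (Finset.mem_filter.1 ha).1)
            b (Finset.mem_of_mem_erase (Finset.mem_filter.1 hb).1)) hi
        have hlS' : ∀ x ∈ l, x ∈ S := fun x hx =>
          Finset.mem_of_mem_erase (Finset.mem_filter.1 (hlS x hx)).1
        by_cases hij : j = i
        · subst hij
          refine ⟨j, v :: l, by simpa [hv] using hlS',
            List.pairwise_cons.2 ⟨fun x hx => (Finset.mem_filter.1 (hlS x hx)).2, hl⟩, ?_⟩
          have := hz j
          simp only [Function.update_self] at hlen
          simp only [List.length_cons]
          omega
        · exact ⟨j, l, hlS', hl, by simpa [hij] using hlen⟩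
      · obtain ⟨j, l, hlS, hl, hlen⟩ := hN i _ E (fun a ha b hb =>
          hE a (Finset.mem_of_mem_erase (Finset.mem_filter.1 ha).1)
            b (Finset.mem_of_mem_erase (Finset.mem_filter.1 hb).1)) hi
        have hlS' : ∀ x ∈ l, x ∈ S := fun x hx =>
          Finset.mem_of_mem_erase (Finset.mem_filter.1 (hlS x hx)).1
        by_cases hij : j = i
        · subst hij
          refine ⟨j, l ++ [v], ?_, List.pairwise_append.2 ⟨hl, List.pairwise_singleton _ _, ?_⟩, ?_⟩
          · intro x hx
            rcases List.mem_append.1 hx with hx | hx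
            · exact hlS' x hx
            · rwa [List.mem_singleton.1 hx]
          · intro x hx y hy
            rw [List.mem_singleton.1 hy]
            exact (Finset.mem_filter.1 (hlS x hx)).2
          · have := hz j
            simp only [Function.update_self] at hlen
            simp only [List.length_append, List.length_singleton]
            omega
        · exact ⟨j, l, hlS', hl, by simpa [hij] using hlen⟩
    · push Not at hbig
      exfalso
      have hsub : S.erase v ⊆ Finset.univ.biUnion fun i =>
          (S.erase v).filter (E i v) ∪ (S.erase v).filter (E i · v) := by
        intro u hu
        obtain ⟨i, hi⟩ := hE v hv u (Finset.mem_of_mem_erase hu) (Finset.ne_of_mem_erase hu).symm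
        simp only [Finset.mem_biUnion, Finset.mem_univ, true_and, Finset.mem_union,
          Finset.mem_filter]
        exact ⟨i, hi.imp (⟨hu, ·⟩) (⟨hu, ·⟩)⟩
      have h1 := (Finset.card_le_card hsub).trans Finset.card_biUnion_le
      have h2 : ∑ i, ((S.erase v).filter (E i v) ∪ (S.erase v).filter (E i · v)).card
          ≤ ∑ i, (N i + N i) :=
        Finset.sum_le_sum fun i _ => (Finset.card_union_le _ _).trans
          (add_le_add (hbig i).1.le (hbig i).2.le)
      rw [Finset.card_erase_of_mem hv] at h1
      omega

theorem exists_ramseyProperty (t m : ℕ) : ∃ n, 0 < n ∧ RamseyProperty t m n := by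
  classical
  obtain ⟨N, hN⟩ := exists_chain_of_card_le ℕ t _ (fun _ => m) rfl
  refine ⟨N + 1, N.succ_pos, fun G hG χ => ?_⟩
  obtain ⟨i, l', hl'S, hl', hlen'⟩ := hN (Finset.range (N + 1))
    (fun i u v => ∃ (hu : u < N + 1) (hv : v < N + 1) (h : G.Adj ⟨u, hu⟩ ⟨v, hv⟩),
      χ _ _ h = i)
    (fun u hu v hv huv => by
      rw [Finset.mem_range] at hu hv
      rcases (hG.2 ⟨u, hu⟩ ⟨v, hv⟩ (by simpa using huv)).or with h | h
      · exact ⟨_, Or.inl ⟨hu, hv, h, rfl⟩⟩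
      · exact ⟨_, Or.inr ⟨hv, hu, h, rfl⟩⟩) (by simp)
  obtain ⟨l, hl, hlen⟩ : ∃ l : List (Fin (N + 1)),
      l.Pairwise (fun u v => ∃ h : G.Adj u v, χ u v h = i) ∧ l.length = m := by
    refine ⟨l'.pmap (fun x hx => ⟨x, Finset.mem_range.1 hx⟩) hl'S, ?_, by simpa using hlen'⟩
    rw [List.pairwise_pmap]
    exact hl'.imp fun ⟨_, _, h⟩ _ _ => h
  have hirr : ∀ a b, G.Adj a b → ¬ G.Adj b a := fun a b hab hba => by
    have hne : a ≠ b := by rintro rfl; exact hG.1 _ hab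
    rcases hG.2 a b hne with h | h
    · exact h.2 hba
    · exact h.2 hab
  rw [List.pairwise_iff_get] at hl
  -- Edges within the list only go forward, so transitivity is inherited from the order of
  -- positions.
  have hlt : ∀ p q, G.Adj (l.get p) (l.get q) → p < q := by
    intro p q hpq
    by_contra hle
    rcases (not_lt.1 hle).lt_or_eq with h | h
    · obtain ⟨h', -⟩ := hl q p h
      exact hirr _ _ hpq h'
    · subst h
      exact hG.1 _ hpq
  refine ⟨l.toFinset, ?_, ?_, i, ?_⟩
  · rw [List.toFinset_card_of_nodup, hlen]
    rw [List.Nodup, List.pairwise_iff_get]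
    intro p q hpq heq
    obtain ⟨h', -⟩ := hl p q hpq
    rw [heq] at h'
    exact hG.1 _ h'
  · intro a ha b hb c hc hab hbc
    rw [List.mem_toFinset] at ha hb hc
    obtain ⟨p, rfl⟩ := List.get_of_mem ha
    obtain ⟨q, rfl⟩ := List.get_of_mem hb
    obtain ⟨r, rfl⟩ := List.get_of_mem hc
    exact (hl p r ((hlt _ _ hab).trans (hlt _ _ hbc))).1
  · intro a ha b hb hab
    rw [List.mem_toFinset] at ha hb
    obtain ⟨p, rfl⟩ := List.get_of_mem ha
    obtain ⟨q, rfl⟩ := List.get_of_mem hb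
    exact (hl p q (hlt _ _ hab)).2

theorem HasCover.lt_directedRamsey {t m N : ℕ} (h : HasCover t m N) :
    N + 1 ≤ directedRamsey t m := by
  refine le_csInf (exists_ramseyProperty t m) fun n hn => ?_
  by_contra hlt
  exact (h.mono (by omega)).not_ramseyProperty hn.2

/-! ### Exhaustive chain search -/

/-- No list of `k` elements of `l` is pairwise related by `e`. -/
def noChain {α : Type*} (e : α → α → Bool) : ℕ → List α → Bool
  | 0, _ => false
  | k + 1, l => l.all fun v => noChain e k (l.filter (e v))

theorem noChain_spec {α : Type*} (e : α → α → Bool) (k : ℕ) :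
    ∀ l, noChain e k l = true → ∀ c : List α, (∀ x ∈ c, x ∈ l) →
      c.Pairwise (fun x y => e x y = true) → c.length ≠ k := by
  induction k with
  | zero => simp [noChain]
  | succ k ih =>
    intro l hl c hc hp
    cases c with
    | nil => simp
    | cons a c =>
      rw [noChain, List.all_eq_true] at hl
      rw [List.pairwise_cons] at hp
      have := ih _ (hl a (hc a (by simp))) c
        (fun x hx => List.mem_filter.2 ⟨hc x (by simp [hx]), hp.1 x hx⟩) hp.2
      simpa using this

/-! ### Cyclotomic covers -/

section Cyclotomic

variable {F : Type*} [Field F]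

/-- No chain of length `k` for differences with `n`-th power `1` lies beyond both `0` and `1`. -/
def NoChainBeyond (F : Type*) [Field F] (n k : ℕ) : Prop :=
  ∀ r : List F, (∀ x ∈ r, x ^ n = 1 ∧ (x - 1) ^ n = 1) →
    r.Pairwise (fun x y => (y - x) ^ n = 1) → r.length ≠ k

/-- The map `x ↦ (x - a) / (b - a)` sends the first two terms `a, b` to `0, 1` and every difference
to an `n`-th root of unity. -/
theorem NoChainBeyond.length_ne {n k : ℕ} (H : NoChainBeyond F n k) (hn : n ≠ 0) {c : F}
    (hc : c ≠ 0) (l : List F) (hl : l.Pairwise (fun x y => (y - x) ^ n = c ^ n)) :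
    l.length ≠ k + 2 := by
  rcases l with _ | ⟨a, _ | ⟨b, r⟩⟩
  · simp
  · simp
  simp only [List.pairwise_cons, List.mem_cons, forall_eq_or_imp] at hl
  obtain ⟨⟨hab, ha⟩, hb, hr⟩ := hl
  have hcn : c ^ n ≠ 0 := pow_ne_zero _ hc
  have hba : b - a ≠ 0 := by
    intro h
    rw [h, zero_pow hn] at hab
    exact hcn hab.symm
  have key : ∀ x y : F, (y - x) ^ n = c ^ n →
      ((y - a) * (b - a)⁻¹ - (x - a) * (b - a)⁻¹) ^ n = 1 := by
    intro x y hxy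
    rw [← sub_mul, sub_sub_sub_cancel_right, mul_pow, inv_pow, hab, hxy, mul_inv_cancel₀ hcn]
  have := H (r.map fun x => (x - a) * (b - a)⁻¹) (by
    intro x hx
    obtain ⟨y, hy, rfl⟩ := List.mem_map.1 hx
    constructor
    · simpa using key a y (ha y hy)
    · simpa [mul_inv_cancel₀ hba] using key b y (hb y hy))
    (List.pairwise_map.2 (hr.imp fun {x y} => key x y))
  simpa using this

theorem primitiveRoot_pow_half {ω : F} {t : ℕ} (ht : 0 < t)
    (hω : IsPrimitiveRoot ω (2 * t)) : ω ^ t = -1 := by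
  have h1 : (ω ^ t) ^ 2 = 1 := by rw [← pow_mul, mul_comm, hω.pow_eq_one]
  rw [sq] at h1
  exact (mul_self_eq_one_iff.1 h1).resolve_left (hω.pow_ne_one_of_pos_of_lt ht.ne' (by omega))

/-- `x ^ n` is a power `ω ^ j` with `j < 2t`; as `n` is odd and `ω ^ t = -1`, negating `x` shifts
`j` by `t`. -/
theorem exists_class [Fintype F] {n t : ℕ} {ω : F} (ht : 0 < t) (hn : Odd n)
    (hω : IsPrimitiveRoot ω (2 * t)) (hq : Fintype.card F = 2 * t * n + 1) {x : F} (hx : x ≠ 0) :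
    ∃ i : Fin t, x ^ n = ω ^ (i : ℕ) ∨ (-x) ^ n = ω ^ (i : ℕ) := by
  have h1 : (x ^ n) ^ (2 * t) = 1 := by
    rw [← pow_mul, mul_comm]
    simpa [hq] using FiniteField.pow_card_sub_one_eq_one x hx
  have : NeZero (2 * t) := ⟨by omega⟩
  obtain ⟨j, hj, hjx⟩ := hω.eq_pow_of_pow_eq_one h1
  by_cases hjt : j < t
  · exact ⟨⟨j, hjt⟩, Or.inl hjx.symm⟩
  · refine ⟨⟨j - t, by omega⟩, Or.inr ?_⟩
    have h2 : ω ^ j = ω ^ (j - t) * ω ^ t := by rw [← pow_add]; congr 1; omega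
    rw [hn.neg_pow, ← hjx, h2, primitiveRoot_pow_half ht hω]
    simp

/-- The cyclotomic tournament on `F`: the color of `x → y` is the class of `y - x`. -/
theorem chainFreeCover_cyclotomic [Fintype F] {n t k : ℕ} {h : F} (ht : 0 < t) (hn : Odd n)
    (hω : IsPrimitiveRoot (h ^ n) (2 * t)) (hq : Fintype.card F = 2 * t * n + 1)
    (H : NoChainBeyond F n k) :
    ChainFreeCover (fun (i : Fin t) (x y : F) => (y - x) ^ n = (h ^ n) ^ (i : ℕ)) (k + 2) where
  total u v huv := by
    simpa using exists_class ht hn hω hq (sub_ne_zero.2 huv.symm)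
  chainFree i l hl := by
    have hh : h ≠ 0 := by
      rintro rfl
      rw [zero_pow hn.pos.ne'] at hω
      exact hω.ne_zero (by omega) rfl
    refine H.length_ne hn.pos.ne' (pow_ne_zero i hh) l ?_
    simpa only [← pow_mul, mul_comm] using hl

/-! ### Doubling by plane determinants -/

/-- A representative in `F × F` of a point of the projective line. -/
def projRep : Option F → F × F
  | none => (1, 0)
  | some a => (a, 1)

/-- The determinant of two vectors in the plane. -/
def planeDet (u v : F × F) : F := u.1 * v.2 - u.2 * v.1

theorem planeDet_smul (a b : F) (u v : F × F) :
    planeDet (a • u) (b • v) = a * b * planeDet u v := by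
  simp only [planeDet, Prod.smul_fst, Prod.smul_snd, smul_eq_mul]
  ring

theorem planeDet_self (u : F × F) : planeDet u u = 0 := by
  simp only [planeDet]; ring

theorem planeDet_swap (u v : F × F) : planeDet v u = -planeDet u v := by
  simp only [planeDet]; ring

theorem planeDet_projRep_ne_zero {p q : Option F} (h : p ≠ q) :
    planeDet (projRep p) (projRep q) ≠ 0 := by
  rcases p with _ | a <;> rcases q with _ | b <;> simp [planeDet, projRep, sub_eq_zero] at h ⊢
  exact h

theorem exists_planeDet_eq_one {u v : F × F} (h : planeDet u v ≠ 0) :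
    ∃ w, planeDet u w = 1 :=
  ⟨(planeDet u v)⁻¹ • v, by
    have := planeDet_smul 1 (planeDet u v)⁻¹ u v
    rw [one_smul] at this
    rw [this, one_mul, inv_mul_cancel₀ h]⟩

/-- A chain whose elements are all related to a vector `u` embeds into a cyclotomic chain. -/
theorem NoChainBeyond.planeDet_length_ne {n k : ℕ} (H : NoChainBeyond F n k) (hn : Odd n) {c : F}
    (hc : c ≠ 0) (u : F × F) (l : List (F × F)) (hu : ∀ w ∈ l, planeDet u w ^ n = c ^ n)
    (hl : l.Pairwise (fun v w => planeDet v w ^ n = c ^ n)) : l.length ≠ k + 2 := by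
  rcases l with _ | ⟨v₀, l'⟩
  · simp
  have hcn : c ^ n ≠ 0 := pow_ne_zero _ hc
  have hne : ∀ w ∈ v₀ :: l', planeDet u w ≠ 0 := fun w hw h0 => by
    have := hu w hw
    rw [h0, zero_pow hn.pos.ne'] at this
    exact hcn this.symm
  obtain ⟨u', hu'⟩ := exists_planeDet_eq_one (hne v₀ (by simp))
  have := H.length_ne hn.pos.ne' (c := -c⁻¹) (neg_ne_zero.2 (inv_ne_zero hc))
    ((v₀ :: l').map fun w => planeDet w u' / planeDet u w) (by
      rw [List.pairwise_map]
      refine hl.imp_of_mem fun {v w} hv hw hvw => ?_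
      have hv0 := hne v hv
      have hw0 := hne w hw
      -- The Plücker relation, with `det(u, u') = 1`: determinants become differences of slopes,
      -- whose class is that of `-c⁻¹`.
      have hid : planeDet v w = planeDet u v * planeDet u w *
          -(planeDet w u' / planeDet u w - planeDet v u' / planeDet u v) := by
        field_simp
        simp only [planeDet] at hu' ⊢
        linear_combination (-(v.1 * w.2 - v.2 * w.1)) * hu'
      rw [hid, mul_pow, mul_pow, hu v hv, hu w hw, hn.neg_pow] at hvw
      rw [hn.neg_pow, inv_pow]
      generalize (planeDet w u' / planeDet u w - planeDet v u' / planeDet u v) ^ n = d at hvw ⊢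
      field_simp
      have h3 : c ^ n * (-c ^ n * d) = c ^ n * 1 := by linear_combination hvw
      linear_combination -mul_left_cancel₀ hcn h3)
  simpa using this

/-- The vector attached to a vertex of the doubled cyclotomic tournament. -/
def planeVec {t : ℕ} (h : F) (u : Option F × Fin t) : F × F := h ^ (u.2 : ℕ) • projRep u.1

theorem planeDet_planeVec {t : ℕ} (h : F) (u v : Option F × Fin t) :
    planeDet (planeVec h u) (planeVec h v) =
      h ^ (u.2 : ℕ) * h ^ (v.2 : ℕ) * planeDet (projRep u.1) (projRep v.1) :=
  planeDet_smul _ _ _ _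

/-- The edges of the doubled cyclotomic tournament: vertices are nonzero vectors of the plane up to
`n`-th roots of unity, and the color is the class of the determinant. -/
def doubledRel (t n : ℕ) (h : F) (i : Fin t) (u v : Option F × Fin (2 * t)) : Prop :=
  planeDet (planeVec h u) (planeVec h v) ^ n = (h ^ n) ^ (i : ℕ) ∨ (u.1 = v.1 ∧ u.2 < v.2)

/-- By bilinearity the level of a vertex enters the determinant only as a scalar factor; the rest
cancels. -/
theorem pow_eq_of_planeDet {t n : ℕ} {h c : F} {a b w : Option F × Fin (2 * t)} (hc : c ≠ 0)
    (hab : a.1 = b.1) (ha : planeDet (planeVec h a) (planeVec h w) ^ n = c)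
    (hb : planeDet (planeVec h b) (planeVec h w) ^ n = c) :
    (h ^ n) ^ (a.2 : ℕ) = (h ^ n) ^ (b.2 : ℕ) := by
  rw [planeDet_planeVec, mul_assoc, mul_pow] at ha hb
  rw [hab] at ha
  have h0 : (h ^ (w.2 : ℕ) * planeDet (projRep b.1) (projRep w.1)) ^ n ≠ 0 := by
    intro h0
    rw [h0, mul_zero] at ha
    exact hc ha.symm
  have := mul_right_cancel₀ h0 (ha.trans hb.symm)
  rwa [← pow_mul, ← pow_mul, mul_comm n, mul_comm n, pow_mul, pow_mul]

theorem add_le_of_sq_pow_eq {t : ℕ} {ω : F} (hω : IsPrimitiveRoot ω (2 * t)) {a b : ℕ}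
    (hab : a < b) (h : (ω ^ a) ^ 2 = (ω ^ b) ^ 2) : a + t ≤ b := by
  have h0 : ω ≠ 0 ∨ t = 0 := by
    by_cases ht : t = 0
    · exact Or.inr ht
    · exact Or.inl (hω.ne_zero (by omega))
  rcases h0 with h0 | rfl
  · have h1 : ω ^ (2 * (b - a)) = 1 := by
      have h2 : (ω ^ b) ^ 2 = (ω ^ a) ^ 2 * ω ^ (2 * (b - a)) := by
        rw [← pow_mul, ← pow_mul, ← pow_add]; congr 1; omega
      rw [h2] at h
      exact (mul_left_cancel₀ (pow_ne_zero _ (pow_ne_zero _ h0)) (by rw [← h, mul_one])).symm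
    have := Nat.le_of_dvd (by omega) (hω.dvd_of_pow_eq_one _ h1)
    omega
  · omega

/-- Call the vertices over one projective point a fibre. If the first `k + 3` terms lie in distinct
fibres, the first of them turns the next `k + 2` into a forbidden cyclotomic chain. Otherwise two
share a fibre, which forces the last term, and then all terms, into it; but a fibre has only `2t < k
+ 4` vertices. -/
theorem chainFreeCover_doubled [Fintype F] {n t k : ℕ} {h : F} (ht : 0 < t) (hn : Odd n)
    (hω : IsPrimitiveRoot (h ^ n) (2 * t)) (hq : Fintype.card F = 2 * t * n + 1)
    (H : NoChainBeyond F n k) (htk : 2 * t < k + 4) :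
    ChainFreeCover (doubledRel t n h) (k + 4) := by
  have hh : h ≠ 0 := by
    rintro rfl
    rw [zero_pow hn.pos.ne'] at hω
    exact hω.ne_zero (by omega) rfl
  have hdet : ∀ u v : Option F × Fin (2 * t), u.1 ≠ v.1 →
      planeDet (planeVec h u) (planeVec h v) ≠ 0 := fun u v huv => by
    rw [planeDet_planeVec]
    exact mul_ne_zero (mul_ne_zero (pow_ne_zero _ hh) (pow_ne_zero _ hh))
      (planeDet_projRep_ne_zero huv)
  have hne : ∀ {i u v}, doubledRel t n h i u v → u.1 ≠ v.1 →
      planeDet (planeVec h u) (planeVec h v) ^ n = (h ^ n) ^ (i : ℕ) :=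
    fun hr huv => hr.resolve_right fun h' => huv h'.1
  have hlt : ∀ {i u v}, doubledRel t n h i u v → u.1 = v.1 → u.2 < v.2 := by
    rintro i u v (hr | hr) huv
    · rw [planeDet_planeVec, huv, planeDet_self, mul_zero, zero_pow hn.pos.ne'] at hr
      exact absurd hr.symm (pow_ne_zero _ (pow_ne_zero _ hh))
    · exact hr.2
  refine ⟨fun u v huv => ?_, fun i l hl hlen => ?_⟩
  · by_cases h1 : u.1 = v.1
    · have h2 : u.2 ≠ v.2 := fun h2 => huv (Prod.ext h1 h2)
      -- Pairs in one fibre are related in every colour, so any choice would do.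
      exact ⟨⟨0, ht⟩, (lt_or_gt_of_ne h2).imp (fun h' => Or.inr ⟨h1, h'⟩)
        fun h' => Or.inr ⟨h1.symm, h'⟩⟩
    · obtain ⟨i, hi⟩ := exists_class ht hn hω hq (hdet u v h1)
      rw [← planeDet_swap] at hi
      exact ⟨i, hi.imp Or.inl Or.inl⟩
  have hci : (h ^ n) ^ (i : ℕ) ≠ 0 := pow_ne_zero _ (pow_ne_zero _ hh)
  obtain ⟨L, z, rfl⟩ : ∃ L z, l = L ++ [z] :=
    ⟨_, _, (List.dropLast_append_getLast (by rintro rfl; simp at hlen : l ≠ [])).symm⟩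
  have hlenL : L.length = k + 3 := by simpa using hlen
  by_cases hfib : L.Pairwise (fun u v => u.1 ≠ v.1)
  · have hL := ((List.pairwise_append.1 hl).1).imp₂ (fun u v hr huv => hne hr huv) hfib
    rcases L with _ | ⟨u, L⟩
    · simp at hlenL
    rw [List.pairwise_cons] at hL
    simp only [← pow_mul, mul_comm n] at hL
    simp only [pow_mul] at hL
    refine H.planeDet_length_ne hn (pow_ne_zero i hh) (planeVec h u) (L.map (planeVec h)) ?_
      (List.pairwise_map.2 hL.2) (by simpa using hlenL)
    intro w hw
    obtain ⟨v, hv, rfl⟩ := List.mem_map.1 hw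
    exact hL.1 v hv
  · rw [List.pairwise_iff_forall_sublist] at hfib
    push Not at hfib
    obtain ⟨a, b, hsub, hab⟩ := hfib
    have hrab := (List.pairwise_pair.1 ((List.pairwise_append.1 hl).1.sublist hsub))
    have haL : a ∈ L := hsub.subset (by simp)
    have hbL : b ∈ L := hsub.subset (by simp)
    have hraz := (List.pairwise_append.1 hl).2.2 a haL z (by simp)
    have hrbz := (List.pairwise_append.1 hl).2.2 b hbL z (by simp)
    have hlt1 := hlt hrab hab
    have haz : a.1 = z.1 := by
      by_contra haz
      have := hω.pow_inj a.2.2 b.2.2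
        (pow_eq_of_planeDet hci hab (hne hraz haz) (hne hrbz (hab ▸ haz)))
      exact hlt1.ne (Fin.ext this)
    have hlt2 := hlt hrbz (hab.symm.trans haz)
    have hall : ∀ w ∈ L ++ [z], w.1 = a.1 := by
      intro w hw
      by_contra hwa
      -- Squaring removes the sign that depends on whether `w` comes before or after `x`.
      have hsq : ∀ x ∈ L ++ [z], x.1 = a.1 →
          planeDet (planeVec h x) (planeVec h w) ^ (n * 2) = ((h ^ n) ^ (i : ℕ)) ^ 2 := by
        intro x hx hxa
        have hxw : x ≠ w := by rintro rfl; exact hwa hxa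
        have hor : doubledRel t n h i x w ∨ doubledRel t n h i w x := by
          obtain ⟨p, rfl⟩ := List.get_of_mem hx
          obtain ⟨q, rfl⟩ := List.get_of_mem hw
          have hl' := List.pairwise_iff_get.1 hl
          have hpq : p ≠ q := by rintro rfl; exact hxw rfl
          exact (lt_or_gt_of_ne hpq).imp (hl' p q) (hl' q p)
        rw [pow_mul]
        rcases hor with hr | hr
        · rw [hne hr (hxa ▸ Ne.symm hwa)]
        · rw [← hne hr (hxa ▸ hwa), planeDet_swap (planeVec h w), hn.neg_pow, neg_sq]
      have hsq' : ∀ x ∈ L ++ [z], x.1 = a.1 → ∀ y ∈ L ++ [z], y.1 = a.1 →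
          ((h ^ n) ^ (x.2 : ℕ)) ^ 2 = ((h ^ n) ^ (y.2 : ℕ)) ^ 2 := by
        intro x hx hxa y hy hya
        have := pow_eq_of_planeDet (pow_ne_zero 2 hci) (hxa.trans hya.symm) (hsq x hx hxa)
          (hsq y hy hya)
        rw [pow_mul] at this
        exact (pow_right_comm _ _ _).trans (this.trans (pow_right_comm _ _ _))
      have haM : a ∈ L ++ [z] := by simp [haL]
      have hbM : b ∈ L ++ [z] := by simp [hbL]
      have h1 := add_le_of_sq_pow_eq hω hlt1 (hsq' a haM rfl b hbM hab.symm)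
      have h2 := add_le_of_sq_pow_eq hω hlt2 (hsq' b hbM hab.symm z (by simp) haz.symm)
      -- The levels of `a, b, z` rise by at least `t` twice, yet all lie below `2t`.
      have := z.2.2
      omega
    have hnodup : ((L ++ [z]).map Prod.snd).Nodup :=
      List.pairwise_map.2 (hl.imp_of_mem fun {u v} hu hv hr =>
        (hlt hr ((hall u hu).trans (hall v hv).symm)).ne)
    have := hnodup.length_le_card
    rw [List.length_map, hlen, Fintype.card_fin] at this
    omega

end Cyclotomic

theorem isPrimitiveRoot_of_pow_eq_neg_one {F : Type*} [Field F] {ω : F} {s : ℕ}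
    (h2 : (-1 : F) ≠ 1) (h : ω ^ 2 ^ s = -1) : IsPrimitiveRoot ω (2 ^ (s + 1)) := by
  have h1 : orderOf ω = 2 ^ (s + 1) := by
    have : Fact (Nat.Prime 2) := ⟨Nat.prime_two⟩
    refine orderOf_eq_prime_pow (by rwa [h]) ?_
    rw [pow_succ, pow_mul, h]
    norm_num
  exact h1 ▸ IsPrimitiveRoot.orderOf ω

/-! ### Quartic residues modulo 829 -/

section Field829

instance fact_prime_829 : Fact (Nat.Prime 829) := ⟨by norm_num⟩

/-- Whether `b - a` is a quartic residue modulo `829`. -/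
def quarticRel (a b : ℕ) : Bool := Nat.beq ((b + (829 - a)) ^ 207 % 829) 1

theorem quarticRel_val {x y : ZMod 829} (h : (y - x) ^ 207 = 1) :
    quarticRel x.val y.val = true := by
  rw [quarticRel, Nat.beq_eq]
  have hx := x.val_lt
  have h1 : ((((y.val + (829 - x.val)) ^ 207 : ℕ) : ZMod 829)) = ((1 : ℕ) : ZMod 829) := by
    rw [Nat.cast_pow, Nat.cast_add, Nat.cast_sub hx.le, ZMod.natCast_self]
    simpa [← sub_eq_add_neg] using h
  exact (ZMod.natCast_eq_natCast_iff' _ _ _).1 h1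

theorem noChain_quarticRel :
    noChain quarticRel 4 ((List.range 829).filter fun a => quarticRel 0 a && quarticRel 1 a) =
      true := by
  decide +kernel

theorem noChainBeyond_829 : NoChainBeyond (ZMod 829) 207 4 := by
  intro r hr hp
  have := noChain_spec _ _ _ noChain_quarticRel (r.map ZMod.val) (by
    intro a ha
    obtain ⟨x, hx, rfl⟩ := List.mem_map.1 ha
    have h0 : quarticRel (0 : ZMod 829).val x.val = true :=
      quarticRel_val (by simpa using (hr x hx).1)
    have h1 : quarticRel (1 : ZMod 829).val x.val = true := quarticRel_val (hr x hx).2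
    rw [List.mem_filter, List.mem_range, Bool.and_eq_true]
    exact ⟨x.val_lt, h0, h1⟩)
    (List.pairwise_map.2 (hp.imp quarticRel_val))
  simpa using this

theorem isPrimitiveRoot_829 : IsPrimitiveRoot ((2 : ZMod 829) ^ 207) (2 * 2) := by
  refine isPrimitiveRoot_of_pow_eq_neg_one (s := 1) ?_ ?_ <;> decide +kernel

theorem hasCover_829 : HasCover 2 6 829 :=
  (chainFreeCover_cyclotomic two_pos (by decide) isPrimitiveRoot_829 (ZMod.card 829)
    noChainBeyond_829).hasCover (by simp) (by simp)

theorem hasCover_3320 : HasCover 2 8 3320 :=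
  (chainFreeCover_doubled two_pos (by decide) isPrimitiveRoot_829 (ZMod.card 829)
    noChainBeyond_829 (by norm_num)).hasCover (by simp) (by simp)

end Field829

/-! ### Octic residues in the field of order 169 -/

section Field169

/-- The field with `169` elements, as `𝔽₁₃(√2)`. -/
abbrev F169 : Type := QuadraticAlgebra (ZMod 13) 2 0

instance fact_not_square_169 : Fact (∀ r : ZMod 13, r ^ 2 ≠ 2 + 0 * r) := ⟨by decide⟩

instance fact_prime_13 : Fact (Nat.Prime 13) := ⟨by norm_num⟩

instance fintype_F169 : Fintype F169 := Fintype.ofEquiv _ (QuadraticAlgebra.equivProd 2 0).symm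

theorem card_F169 : Fintype.card F169 = 169 := by
  rw [Fintype.card_congr (QuadraticAlgebra.equivProd (2 : ZMod 13) 0)]
  simp

theorem noChainBeyond_169 : NoChainBeyond F169 21 1 := by
  have key : ∀ a b : ZMod 13, ¬ ((⟨a, b⟩ : F169) ^ 21 = 1 ∧ ((⟨a, b⟩ : F169) - 1) ^ 21 = 1) := by
    decide +kernel
  intro r hr _ hlen
  obtain ⟨x, rfl⟩ := List.length_eq_one_iff.1 hlen
  exact key x.re x.im (hr x (by simp))

theorem isPrimitiveRoot_169 : IsPrimitiveRoot ((⟨0, 1⟩ : F169) ^ 21) (2 * 4) := by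
  refine isPrimitiveRoot_of_pow_eq_neg_one (s := 2) ?_ ?_ <;> decide +kernel

theorem hasCover_169 : HasCover 4 3 169 :=
  (chainFreeCover_cyclotomic four_pos (by decide) isPrimitiveRoot_169 card_F169
    noChainBeyond_169).hasCover (by simp) card_F169.ge

end Field169

/-! ### Squares in the field of order 27 -/

section Field27

/-- The field with `27` elements, as `𝔽₃[X]/(X³ - X - 1)`. -/
@[ext]
structure F27 where
  c0 : ZMod 3
  c1 : ZMod 3
  c2 : ZMod 3
deriving DecidableEq, Fintype

namespace F27

instance : Zero F27 := ⟨⟨0, 0, 0⟩⟩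
instance : One F27 := ⟨⟨1, 0, 0⟩⟩
instance : Add F27 := ⟨fun x y => ⟨x.c0 + y.c0, x.c1 + y.c1, x.c2 + y.c2⟩⟩
instance : Neg F27 := ⟨fun x => ⟨-x.c0, -x.c1, -x.c2⟩⟩
-- Reduction uses `X³ = X + 1` and `X⁴ = X² + X`.
instance : Mul F27 := ⟨fun x y =>
  ⟨x.c0 * y.c0 + (x.c1 * y.c2 + x.c2 * y.c1),
    x.c0 * y.c1 + x.c1 * y.c0 + (x.c1 * y.c2 + x.c2 * y.c1) + x.c2 * y.c2,
    x.c0 * y.c2 + x.c1 * y.c1 + x.c2 * y.c0 + x.c2 * y.c2⟩⟩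

theorem zero_def : (0 : F27) = ⟨0, 0, 0⟩ := rfl
theorem one_def : (1 : F27) = ⟨1, 0, 0⟩ := rfl
theorem add_def (x y : F27) : x + y = ⟨x.c0 + y.c0, x.c1 + y.c1, x.c2 + y.c2⟩ := rfl
theorem neg_def (x : F27) : -x = ⟨-x.c0, -x.c1, -x.c2⟩ := rfl
theorem mul_def (x y : F27) : x * y = ⟨x.c0 * y.c0 + (x.c1 * y.c2 + x.c2 * y.c1),
    x.c0 * y.c1 + x.c1 * y.c0 + (x.c1 * y.c2 + x.c2 * y.c1) + x.c2 * y.c2,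
    x.c0 * y.c2 + x.c1 * y.c1 + x.c2 * y.c0 + x.c2 * y.c2⟩ := rfl

instance : CommRing F27 where
  add_assoc x y z := by simp only [add_def]; ext <;> ring
  zero_add x := by simp only [add_def, zero_def, zero_add]
  add_zero x := by simp only [add_def, zero_def, add_zero]
  add_comm x y := by simp only [add_def]; ext <;> ring
  neg_add_cancel x := by simp only [add_def, neg_def, zero_def, neg_add_cancel]
  mul_assoc x y z := by simp only [mul_def]; ext <;> ring
  one_mul x := by simp only [mul_def, one_def]; ext <;> ring
  mul_one x := by simp only [mul_def, one_def]; ext <;> ring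
  zero_mul x := by simp only [mul_def, zero_def]; ext <;> ring
  mul_zero x := by simp only [mul_def, zero_def]; ext <;> ring
  left_distrib x y z := by simp only [mul_def, add_def]; ext <;> ring
  right_distrib x y z := by simp only [mul_def, add_def]; ext <;> ring
  mul_comm x y := by simp only [mul_def]; ext <;> ring
  nsmul := nsmulRec
  zsmul := zsmulRec

instance : Field F27 where
  -- Nonzero elements satisfy `x ^ 26 = 1`.
  inv x := x ^ 25
  exists_pair_ne := ⟨0, 1, by decide⟩
  mul_inv_cancel := by decide +kernel
  inv_zero := by decide +kernel
  nnqsmul := _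
  nnqsmul_def _ _ := rfl
  qsmul := _
  qsmul_def _ _ := rfl

end F27

theorem card_F27 : Fintype.card F27 = 27 := by decide +kernel

/-- The elements of `F27`. -/
def listF27 : List F27 :=
  (List.finRange 3).flatMap fun a => (List.finRange 3).flatMap fun b =>
    (List.finRange 3).map fun c => ⟨a, b, c⟩

/-- Whether `y - x` is a nonzero square in `F27`. -/
def squareRel (x y : F27) : Bool := decide ((y - x) ^ 13 = 1)

theorem noChain_squareRel :
    noChain squareRel 4 (listF27.filter fun x => squareRel 0 x && squareRel 1 x) = true := by
  decide +kernel

theorem mem_listF27 : ∀ x : F27, x ∈ listF27 := by decide +kernel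

theorem noChainBeyond_27 : NoChainBeyond F27 13 4 := by
  intro r hr hp
  refine noChain_spec _ _ _ noChain_squareRel r (fun x hx => ?_)
    (hp.imp fun h => decide_eq_true h)
  rw [List.mem_filter, Bool.and_eq_true]
  exact ⟨mem_listF27 x, decide_eq_true (by simpa using (hr x hx).1), decide_eq_true (hr x hx).2⟩

theorem isPrimitiveRoot_27 : IsPrimitiveRoot ((-1 : F27) ^ 13) (2 * 1) := by
  refine isPrimitiveRoot_of_pow_eq_neg_one (s := 0) ?_ ?_ <;> decide +kernel

theorem hasCover_27 : HasCover 1 6 27 :=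
  (chainFreeCover_cyclotomic one_pos (by decide) isPrimitiveRoot_27 card_F27
    noChainBeyond_27).hasCover (by simp) card_F27.ge

theorem hasCover_56 : HasCover 1 8 56 :=
  (chainFreeCover_doubled one_pos (by decide) isPrimitiveRoot_27 card_F27
    noChainBeyond_27 (by norm_num)).hasCover (by simp) (by simp [card_F27])

end Field27

theorem hasCover_three : HasCover 1 3 3 := by
  refine ⟨fun _ u v => v = u + 1, by decide, fun _ l hl hlen => ?_⟩
  obtain ⟨a, b, c, rfl⟩ := List.length_eq_three.1 hlen
  simp only [List.pairwise_cons, List.mem_cons, List.not_mem_nil, or_false,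
    forall_eq_or_imp, forall_eq] at hl
  revert a b c
  decide

end DirectedRamsey

theorem theorem1p2 :
    (∀ t : ℕ, 4 ≤ t →
      169 * 3 ^ (t - 4) + 1 ≤ DirectedRamsey.directedRamsey t 3) ∧
    (∀ t : ℕ, 2 ≤ t →
      829 * 27 ^ (t - 2) + 1 ≤ DirectedRamsey.directedRamsey t 6) ∧
    (∀ t : ℕ, 2 ≤ t →
      3320 * 56 ^ (t - 2) + 1 ≤ DirectedRamsey.directedRamsey t 8) := by
  refine ⟨fun t ht => ?_, fun t ht => ?_, fun t ht => ?_⟩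
  · have h := DirectedRamsey.hasCover_169.mul_pow DirectedRamsey.hasCover_three (t - 4)
    rw [Nat.add_sub_cancel' ht] at h
    exact h.lt_directedRamsey
  · have h := DirectedRamsey.hasCover_829.mul_pow DirectedRamsey.hasCover_27 (t - 2)
    rw [Nat.add_sub_cancel' ht] at h
    exact h.lt_directedRamsey
  · have h := DirectedRamsey.hasCover_3320.mul_pow DirectedRamsey.hasCover_56 (t - 2)
    rw [Nat.add_sub_cancel' ht] at h
    exact h.lt_directedRamsey
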